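/- Let $G$ be a connected, simply connected nilpotent Lie group of real dimension $4n$, let $\Gamma\subset G$ be a discrete subgroup such that $N=\Gamma\backslash G$ is compact, and let $(\mathcal I,\mathcal J,\mathcal K)$ be a hypercomplex structure on $N$ that is inherited from a left-invariant hypercomplex structure on $G$ (so $\mathcal I,\mathcal J,\mathcal K$ are integrable almost complex structures with $\mathcal I\mathcal J=-\mathcal J\mathcal I=\mathcal K$, and $(N,\mathcal I,\mathcal J,\mathcal K)$ is a hypercomplex nilmanifold with $\dim_{\mathbb C}N=2n$). Let $\nabla$ be the Obata connection of $N$, that is, the unique torsion-free connection on $TN$ with $\nabla\mathcal I=\nabla\mathcal J=\nabla\mathcal K=0$. Let $\eta$ be a holomorphic section of the canonical bundle $\Lambda^{2n,0}(N,\mathcal I)$ (i.e. $\bar\partial\eta=0$) that is left-invariant, meaning that its pull-back to $G$ is invariant under all left translations. Then $\eta$ is parallel for the connection induced by $\nabla$ on differential forms: $\nabla\eta=0$. -/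

import Mathlib

open scoped Manifold ContDiff Bundle

noncomputable section

/-! ### The quotient `Γ \ G` of a Lie group by a discrete subgroup -/

section Quotient

/-- The space `Γ \ G` of cosets `Γ g`. -/
def LeftQuotient {G : Type*} [Group G] (Γ : Subgroup G) : Type _ :=
  Quotient (QuotientGroup.rightRel Γ)

namespace LeftQuotient

variable {G : Type*} [Group G]

/-- The canonical projection `π : G → Γ \ G`. -/
def proj (Γ : Subgroup G) (g : G) : LeftQuotient Γ := Quotient.mk _ g

instance [TopologicalSpace G] (Γ : Subgroup G) : TopologicalSpace (LeftQuotient Γ) :=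
  inferInstanceAs (TopologicalSpace (Quotient _))

theorem proj_eq_iff {Γ : Subgroup G} {a b : G} : proj Γ a = proj Γ b ↔ b * a⁻¹ ∈ Γ :=
  Quotient.eq''.trans QuotientGroup.rightRel_apply

theorem proj_surjective (Γ : Subgroup G) : Function.Surjective (proj Γ) := Quotient.mk_surjective

theorem isLocalHomeomorph_proj [TopologicalSpace G] [IsTopologicalGroup G] (Γ : Subgroup G)
    [DiscreteTopology Γ] : IsLocalHomeomorph (proj Γ) :=
  (Topology.IsQuotientMap.isQuotientCoveringMap_of_subgroup
    (f := proj Γ) isQuotientMap_quotient_mk' Γ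
    (isDiscrete_iff_discreteTopology.mpr inferInstance) proj_eq_iff).isCoveringMap.isLocalHomeomorph

variable {E : Type*} [NormedAddCommGroup E] [NormedSpace ℝ E] [TopologicalSpace G]
  [ChartedSpace E G] [LieGroup 𝓘(ℝ, E) ∞ G] (Γ : Subgroup G)

theorem contMDiffAt_comp_proj {φ : OpenPartialHomeomorph (LeftQuotient Γ) G}
    (hφ : ∀ g, φ.symm g = proj Γ g) {h : G} (hh : proj Γ h ∈ φ.source) :
    ContMDiffAt 𝓘(ℝ, E) 𝓘(ℝ, E) ∞ (fun g => φ (proj Γ g)) h := by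
  have : IsTopologicalGroup G := topologicalGroup_of_lieGroup 𝓘(ℝ, E) ∞
  set c : G := φ (proj Γ h) * h⁻¹ with hc
  have hcΓ : c ∈ Γ := by
    rw [hc, ← proj_eq_iff, ← hφ (φ (proj Γ h)), φ.left_inv hh]
  have key : (fun g => φ (proj Γ g)) =ᶠ[nhds h] fun g => c * g := by
    have hopen : IsOpen ((fun g : G => c * g) ⁻¹' φ.target) :=
      φ.open_target.preimage (continuous_const_mul c)
    have hmem : h ∈ (fun g : G => c * g) ⁻¹' φ.target := by
      simpa [hc] using φ.map_source hh
    filter_upwards [hopen.mem_nhds hmem] with g hg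
    have : proj Γ g = proj Γ (c * g) := by
      rw [proj_eq_iff]; simpa using hcΓ
    rw [this, ← hφ, φ.right_inv hg]
  exact (contMDiff_mul_left (I := 𝓘(ℝ, E)) (n := ∞) (a := c)).contMDiffAt.congr_of_eventuallyEq key

variable [DiscreteTopology Γ]

/-- The charts of `Γ \ G` are the local inverses of `π` followed by the charts of `G`. -/
instance : ChartedSpace E (LeftQuotient Γ) :=
  haveI : IsTopologicalGroup G := topologicalGroup_of_lieGroup 𝓘(ℝ, E) ∞
  (isLocalHomeomorph_proj Γ).chartedSpace (proj_surjective Γ)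

instance : IsManifold 𝓘(ℝ, E) ∞ (LeftQuotient Γ) := by
  have : IsTopologicalGroup G := topologicalGroup_of_lieGroup 𝓘(ℝ, E) ∞
  apply isManifold_of_contDiffOn
  rintro _ _ ⟨p, rfl⟩ ⟨q, rfl⟩
  rw [← contMDiffOn_iff_contDiffOn]
  set H := isLocalHomeomorph_proj Γ
  intro y hy
  apply ContMDiffAt.contMDiffWithinAt
  set g := (proj_surjective Γ).hasRightInverse.choose
  set a := chartAt E (g p)
  set b := chartAt E (g q)
  set φ := H.localInverseAt (x := g q)
  simp at hy
  obtain ⟨⟨h1, h1'⟩, h2, h3⟩ := hy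
  have e1 : ContMDiffAt 𝓘(ℝ, E) 𝓘(ℝ, E) ∞ a.symm y :=
    (contMDiffOn_chart_symm (I := 𝓘(ℝ, E)) (n := ∞) (x := g p)).contMDiffAt
      (a.open_target.mem_nhds h1)
  have e2 := contMDiffAt_comp_proj (E := E) Γ (φ := φ) (fun z => by simp [φ]) h2
  have e3 : ContMDiffAt 𝓘(ℝ, E) 𝓘(ℝ, E) ∞ b (φ (proj Γ (a.symm y))) :=
    (contMDiffOn_chart (I := 𝓘(ℝ, E)) (n := ∞) (x := g q)).contMDiffAt
      (b.open_source.mem_nhds h3)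
  have := e3.comp y (e2.comp y e1)
  refine this.congr_of_eventuallyEq (Filter.Eventually.of_forall fun z => ?_)
  simp [φ, a, b]

theorem contMDiff_proj : ContMDiff 𝓘(ℝ, E) 𝓘(ℝ, E) ∞ (proj Γ : G → LeftQuotient Γ) := by
  have : IsTopologicalGroup G := topologicalGroup_of_lieGroup 𝓘(ℝ, E) ∞
  have H := isLocalHomeomorph_proj Γ
  intro h
  rw [contMDiffAt_iff_target]
  refine ⟨H.continuous.continuousAt, ?_⟩
  set g := (proj_surjective Γ).hasRightInverse.choose
  set φ := H.localInverseAt (x := g (proj Γ h))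
  have hs := mem_chart_source E (proj Γ h)
  change proj Γ h ∈ (φ.trans (chartAt E (g (proj Γ h)))).source at hs
  rw [OpenPartialHomeomorph.trans_source] at hs
  have e2 := contMDiffAt_comp_proj (E := E) Γ (φ := φ) (fun z => by simp [φ]) hs.1
  have e3 : ContMDiffAt 𝓘(ℝ, E) 𝓘(ℝ, E) ∞ (chartAt E (g (proj Γ h))) (φ (proj Γ h)) :=
    (contMDiffOn_chart (I := 𝓘(ℝ, E)) (n := ∞)).contMDiffAt
      ((chartAt E _).open_source.mem_nhds hs.2)
  exact ContMDiffAt.comp (f := fun z => φ (proj Γ z)) h e3 e2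

/-- The smooth structure on `Γ \ G` is the one that makes `π` a local diffeomorphism. -/
theorem isLocalDiffeomorph_proj :
    IsLocalDiffeomorph 𝓘(ℝ, E) 𝓘(ℝ, E) ∞ (proj Γ : G → LeftQuotient Γ) := by
  have : IsTopologicalGroup G := topologicalGroup_of_lieGroup 𝓘(ℝ, E) ∞
  have H := isLocalHomeomorph_proj Γ
  intro h
  set ψ := H.localInverseAt (x := h)
  have hψ : ∀ z, ψ.symm z = proj Γ z := fun z => by simp [ψ]
  refine ⟨{ toPartialEquiv := ψ.symm.toPartialEquiv
            open_source := ψ.open_target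
            open_target := ψ.open_source
            contMDiffOn_toFun := ?_
            contMDiffOn_invFun := ?_ }, ?_, ?_⟩
  · exact (contMDiff_proj Γ).contMDiffOn.congr fun z _ => hψ z
  · intro x hx
    apply ContMDiffAt.contMDiffWithinAt
    change ContMDiffAt _ _ _ ψ x
    set g := (proj_surjective Γ).hasRightInverse.choose
    set φ := H.localInverseAt (x := g x)
    set c := chartAt E (g x)
    have hs := mem_chart_source E x
    change x ∈ (φ.trans c).source at hs
    rw [OpenPartialHomeomorph.trans_source] at hs
    have hpx : proj Γ (φ x) = x := H.apply_localInverseAt_of_mem hs.1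
    have e1 : ContMDiffAt 𝓘(ℝ, E) 𝓘(ℝ, E) ∞ (chartAt E x) x :=
      (contMDiffOn_chart (I := 𝓘(ℝ, E)) (n := ∞)).contMDiffAt
        ((chartAt E _).open_source.mem_nhds (mem_chart_source E x))
    have e2 : ContMDiffAt 𝓘(ℝ, E) 𝓘(ℝ, E) ∞ c.symm (c (φ x)) :=
      (contMDiffOn_chart_symm (I := 𝓘(ℝ, E)) (n := ∞)).contMDiffAt
        (c.open_target.mem_nhds (c.map_source hs.2))
    have e3 : ContMDiffAt 𝓘(ℝ, E) 𝓘(ℝ, E) ∞ (fun z => ψ (proj Γ z)) (c.symm (c (φ x))) := by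
      rw [c.left_inv hs.2]
      exact contMDiffAt_comp_proj (E := E) Γ hψ (by rw [hpx]; exact hx)
    have := e3.comp x (e2.comp x e1)
    refine this.congr_of_eventuallyEq ?_
    have hev : ∀ᶠ y in nhds x, y ∈ (φ.trans c).source :=
      (φ.trans c).open_source.mem_nhds (by rw [OpenPartialHomeomorph.trans_source]; exact hs)
    filter_upwards [hev] with y hy
    rw [OpenPartialHomeomorph.trans_source] at hy
    change ψ y = ψ (proj Γ (c.symm (c (φ y))))
    rw [c.left_inv hy.2, H.apply_localInverseAt_of_mem hy.1]
  · exact H.self_mem_localInverseAt_target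
  · exact fun z _ => (hψ z).symm

end LeftQuotient

end Quotient

/-! ### Vector fields, complex structures, hypercomplex structures -/

section Manifold

variable {E : Type*} [NormedAddCommGroup E] [NormedSpace ℝ E]
  {M : Type*} [TopologicalSpace M] [ChartedSpace E M]

/-- Vector fields on `M` (not necessarily smooth). -/
abbrev VField (E : Type*) [NormedAddCommGroup E] [NormedSpace ℝ E]
    (M : Type*) [TopologicalSpace M] [ChartedSpace E M] : Type _ :=
  Π x : M, TangentSpace 𝓘(ℝ, E) x

/-- Fields of endomorphisms of the tangent spaces of `M` (not necessarily smooth). -/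
abbrev EndField (E : Type*) [NormedAddCommGroup E] [NormedSpace ℝ E]
    (M : Type*) [TopologicalSpace M] [ChartedSpace E M] : Type _ :=
  Π x : M, TangentSpace 𝓘(ℝ, E) x →L[ℝ] TangentSpace 𝓘(ℝ, E) x

variable [IsManifold 𝓘(ℝ, E) ∞ M]

/-- `X` is a smooth section of `TM`. -/
def VField.IsSmooth (X : VField E M) : Prop :=
  ContMDiff 𝓘(ℝ, E) 𝓘(ℝ, E).tangent ∞ (fun x => (⟨x, X x⟩ : TangentBundle 𝓘(ℝ, E) M))

/-- `J` is a smooth section of `End(TM)`. -/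
def EndField.IsSmooth (J : EndField E M) : Prop :=
  ContMDiff 𝓘(ℝ, E) (𝓘(ℝ, E).prod 𝓘(ℝ, E →L[ℝ] E)) ∞
    (fun x => Bundle.TotalSpace.mk' (E →L[ℝ] E)
      (E := fun x : M => TangentSpace 𝓘(ℝ, E) x →L[ℝ] TangentSpace 𝓘(ℝ, E) x) x (J x))

/-- The vector field `J X`. -/
def EndField.app (J : EndField E M) (X : VField E M) : VField E M := fun x => J x (X x)

open VectorField in
/-- An integrable almost complex structure: `J² = -1` and the Nijenhuis tensor
`[JX, JY] - [X, Y] - J [JX, Y] - J [X, JY]` vanishes. -/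
structure IsComplexStructure (J : EndField E M) : Prop where
  smooth : J.IsSmooth
  sq : ∀ (x : M) (v : TangentSpace 𝓘(ℝ, E) x), J x (J x v) = -v
  integrable : ∀ X Y : VField E M, X.IsSmooth → Y.IsSmooth → ∀ x : M,
    mlieBracket 𝓘(ℝ, E) (J.app X) (J.app Y) x - mlieBracket 𝓘(ℝ, E) X Y x
      - J x (mlieBracket 𝓘(ℝ, E) (J.app X) Y x) - J x (mlieBracket 𝓘(ℝ, E) X (J.app Y) x) = 0

variable (E M) in
/-- A hypercomplex structure: three complex structures with `IJ = -JI = K`. -/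
structure HypercomplexStructure where
  I : EndField E M
  J : EndField E M
  K : EndField E M
  complex_I : IsComplexStructure I
  complex_J : IsComplexStructure J
  complex_K : IsComplexStructure K
  I_J : ∀ (x : M) (v : TangentSpace 𝓘(ℝ, E) x), I x (J x v) = K x v
  J_I : ∀ (x : M) (v : TangentSpace 𝓘(ℝ, E) x), J x (I x v) = -K x v

variable {M' : Type*} [TopologicalSpace M'] [ChartedSpace E M'] [IsManifold 𝓘(ℝ, E) ∞ M']

/-- `f` is smooth and its differential intertwines `J` and `J'`, i.e. `f` is holomorphic. -/
def IsHolomorphicMap (J : EndField E M) (J' : EndField E M') (f : M → M') : Prop :=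
  ContMDiff 𝓘(ℝ, E) 𝓘(ℝ, E) ∞ f ∧ ∀ (x : M) (v : TangentSpace 𝓘(ℝ, E) x),
    mfderiv 𝓘(ℝ, E) 𝓘(ℝ, E) f x (J x v) = J' (f x) (mfderiv 𝓘(ℝ, E) 𝓘(ℝ, E) f x v)

/-- `f` is holomorphic with respect to each of the three complex structures. -/
def IsHypercomplexMap (A : HypercomplexStructure E M) (A' : HypercomplexStructure E M')
    (f : M → M') : Prop :=
  IsHolomorphicMap A.I A'.I f ∧ IsHolomorphicMap A.J A'.J f ∧ IsHolomorphicMap A.K A'.K f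

/-! ### The Obata connection -/

/-- `∇ J = 0`, i.e. `∇_v (J Y) = J (∇_v Y)`. Recall that `cov Y x v` is `∇_v Y` at `x`. -/
def IsParallelEnd (cov : CovariantDerivative 𝓘(ℝ, E) E (TangentSpace 𝓘(ℝ, E) : M → Type _))
    (J : EndField E M) : Prop :=
  ∀ Y : VField E M, Y.IsSmooth → ∀ (x : M) (v : TangentSpace 𝓘(ℝ, E) x),
    cov (J.app Y) x v = J x (cov Y x v)

/-- `cov` is the Obata connection of the hypercomplex structure `A`: the (necessarily unique)
smooth torsion-free connection on `TM` for which `I`, `J`, `K` are parallel. -/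
structure IsObataConnection [FiniteDimensional ℝ E] [CompleteSpace E]
    (A : HypercomplexStructure E M)
    (cov : CovariantDerivative 𝓘(ℝ, E) E (TangentSpace 𝓘(ℝ, E) : M → Type _)) : Prop where
  smooth : ContMDiffCovariantDerivativeOn E ∞ cov.toFun Set.univ
  torsion_eq_zero : cov.torsion = 0
  parallel_I : IsParallelEnd cov A.I
  parallel_J : IsParallelEnd cov A.J
  parallel_K : IsParallelEnd cov A.K

/-! ### Complex-valued differential forms -/

/-- Complex-valued `p`-forms on `M` (not necessarily smooth). -/
abbrev CForm (E : Type*) [NormedAddCommGroup E] [NormedSpace ℝ E]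
    (M : Type*) [TopologicalSpace M] [ChartedSpace E M] (p : ℕ) : Type _ :=
  Π x : M, TangentSpace 𝓘(ℝ, E) x [⋀^Fin p]→L[ℝ] ℂ

variable {p : ℕ}

/-- `η` is smooth: `η(X₁, …, X_p)` is a smooth function for all smooth vector fields. -/
def CForm.IsSmooth (η : CForm E M p) : Prop :=
  ∀ X : Fin p → VField E M, (∀ k, (X k).IsSmooth) →
    ContMDiff 𝓘(ℝ, E) 𝓘(ℝ, ℂ) ∞ (fun x => η x (fun k => X k x))

/-- `η` has type `(p, 0)` with respect to `J`: it is complex linear in each argument,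
`η(…, J v, …) = i η(…, v, …)`; equivalently its complex multilinear extension vanishes when an
argument is of type `(0, 1)`. -/
def CForm.IsTypePZero (J : EndField E M) (η : CForm E M p) : Prop :=
  ∀ (x : M) (v : Fin p → TangentSpace 𝓘(ℝ, E) x) (k : Fin p),
    η x (Function.update v k (J x (v k))) = Complex.I * η x v

/-- The derivative at `x`, in the direction `v`, of the function `η(X₁, …, X_p)`. -/
def CForm.dirDeriv (η : CForm E M p) (X : Fin p → VField E M) (x : M)
    (v : TangentSpace 𝓘(ℝ, E) x) : ℂ :=
  mfderiv 𝓘(ℝ, E) 𝓘(ℝ, ℂ) (fun y => η y (fun k => X k y)) x v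

open VectorField in
/-- The exterior derivative `(dη)(X₀, …, X_p)` at `x`, by the invariant formula
`∑ᵢ (-1)ⁱ Xᵢ(η(X₀, …, X̂ᵢ, …, X_p)) + ∑_{i<j} (-1)^{i+j} η([Xᵢ, Xⱼ], …, X̂ᵢ, …, X̂ⱼ, …)`.
In the second sum the bracket is moved to the place of `Xⱼ`, which turns the sign into
`-(-1)ⁱ`; the index `k` runs over the positions of the list `X₀, …, X̂ᵢ, …, X_p`, and
`i.succAbove k` is the corresponding `j`. -/
def CForm.d (η : CForm E M p) (X : Fin (p + 1) → VField E M) (x : M) : ℂ :=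
  ∑ i : Fin (p + 1), (-1 : ℂ) ^ (i : ℕ) *
    (η.dirDeriv (fun k => X (i.succAbove k)) x (X i x) -
      ∑ k : Fin p, if i < i.succAbove k then
        η x (Function.update (fun l => X (i.succAbove l) x) k
          (mlieBracket 𝓘(ℝ, E) (X i) (X (i.succAbove k)) x))
      else 0)

/-- The Dolbeault operator on forms `η` of type `(p, 0)`: the value of `∂̄η`, which is the
`(p, 1)`-part of `dη`, on `(Y^{0,1}, X₁, …, X_p)`, where `Y^{0,1} = (Y + i J Y) / 2`. -/
def CForm.dbar (J : EndField E M) (η : CForm E M p) (Y : VField E M) (X : Fin p → VField E M)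
    (x : M) : ℂ :=
  (1 / 2) * (η.d (Fin.cons Y X) x + Complex.I * η.d (Fin.cons (J.app Y) X) x)

/-- `η` is a holomorphic section of `Λ^{p,0}(M, J)`: a smooth form of type `(p, 0)` with
`∂̄η = 0`. -/
structure CForm.IsHolomorphicSection (J : EndField E M) (η : CForm E M p) : Prop where
  smooth : η.IsSmooth
  type_p_zero : η.IsTypePZero J
  dbar_eq_zero : ∀ (Y : VField E M) (X : Fin p → VField E M), Y.IsSmooth →
    (∀ k, (X k).IsSmooth) → ∀ x : M, η.dbar J Y X x = 0

/-- The induced connection on forms: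
`(∇_v η)(X₁, …, X_p) = v(η(X₁, …, X_p)) - ∑ₖ η(X₁, …, ∇_v Xₖ, …, X_p)`. -/
def CForm.covDeriv (cov : CovariantDerivative 𝓘(ℝ, E) E (TangentSpace 𝓘(ℝ, E) : M → Type _))
    (η : CForm E M p) (X : Fin p → VField E M) (x : M) (v : TangentSpace 𝓘(ℝ, E) x) : ℂ :=
  η.dirDeriv X x v - ∑ k : Fin p, η x (Function.update (fun l => X l x) k (cov (X k) x v))

/-- `∇ η = 0`. -/
def CForm.IsParallel (cov : CovariantDerivative 𝓘(ℝ, E) E (TangentSpace 𝓘(ℝ, E) : M → Type _))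
    (η : CForm E M p) : Prop :=
  ∀ X : Fin p → VField E M, (∀ k, (X k).IsSmooth) →
    ∀ (x : M) (v : TangentSpace 𝓘(ℝ, E) x), η.covDeriv cov X x v = 0

end Manifold

/-! ### Left-invariant structures on `G` and `Γ \ G` -/

section Invariant

variable {E : Type*} [NormedAddCommGroup E] [NormedSpace ℝ E]
  {G : Type*} [TopologicalSpace G] [ChartedSpace E G] [Group G] [LieGroup 𝓘(ℝ, E) ∞ G]

/-- Left translations are holomorphic with respect to `I`, `J` and `K`. -/
def HypercomplexStructure.IsLeftInvariant (A : HypercomplexStructure E G) : Prop :=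
  ∀ h : G, IsHypercomplexMap A A (fun g => h * g)

variable (Γ : Subgroup G) [DiscreteTopology Γ]

/-- The hypercomplex structure `A` on `Γ \ G` is inherited from a left-invariant hypercomplex
structure on `G`. -/
def IsInducedHypercomplex (A : HypercomplexStructure E (LeftQuotient Γ)) : Prop :=
  ∃ B : HypercomplexStructure E G,
    B.IsLeftInvariant ∧ IsHypercomplexMap B A (LeftQuotient.proj Γ)

/-- The pull-back of a form on `Γ \ G` to `G`. -/
def pullbackForm {p : ℕ} (η : CForm E (LeftQuotient Γ) p) : CForm E G p := fun g =>
  (η (LeftQuotient.proj Γ g)).compContinuousLinearMap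
    (mfderiv 𝓘(ℝ, E) 𝓘(ℝ, E) (LeftQuotient.proj Γ) g)

/-- A form on `Γ \ G` is left-invariant if its pull-back to `G` is invariant under all left
translations of `G`. -/
def IsLeftInvariantForm {p : ℕ} (η : CForm E (LeftQuotient Γ) p) : Prop :=
  ∀ h g : G, (pullbackForm Γ η (h * g)).compContinuousLinearMap
    (mfderiv 𝓘(ℝ, E) 𝓘(ℝ, E) (fun a => h * a) g) = pullbackForm Γ η g

end Invariant

end

/-! Write p = 2n and σ(η) = conj(η(J·, …, J·)). Since J anticommutes with I and conjugation turns i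
into -i, σ preserves forms of type (p, 0) for I. In this degree such forms on a tangent space make
up a complex line (`AlternatingMap.exists_eq_mul_of_complex_linear`), so σ(η) is pointwise a
multiple of η. If η ≠ 0 is left-invariant, the factor is the same nonzero constant c at every point
(`IsLeftInvariantForm.exists_conj_apply_eq`).

Two facts about ∇η then contradict each other unless ∇η = 0. Because the connection is torsion-free
and ∇I = 0, the (0,1)-part of ∇η is ∂̄η, so holomorphy gives ∇_{IY}η = i∇_Yη
(`CForm.IsHolomorphicSection.covDeriv_app`). Because ∇J = 0 and c is constant, σ(∇_vη) = c∇_vη for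
every real v (`CForm.covDeriv_of_conj_apply_eq`). Since σ is antilinear, taking v = IY gives -ic∇_Yη
= ic∇_Yη, so ∇_Yη = 0. -/

noncomputable section

/-! ### Complex multilinear forms of top degree -/

section LinearAlgebra

variable {V : Type*} [AddCommGroup V] [Module ℝ V]

/-- The complex vector space structure determined by `J` with `J² = -1`. -/
abbrev complexModule (J : V →ₗ[ℝ] V) (hJ : J * J = -1) : Module ℂ V :=
  Module.compHom V (Complex.lift (A := Module.End ℝ V) ⟨J, hJ⟩).toRingHom

theorem complexModule_smul (J : V →ₗ[ℝ] V) (hJ : J * J = -1) (z : ℂ) (v : V) :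
    (letI := complexModule J hJ; z • v) = z.re • v + z.im • J v := by
  change (Complex.lift (A := Module.End ℝ V) ⟨J, hJ⟩ z) v = _
  simp [Complex.liftAux_apply, Module.algebraMap_end_apply]

/-- An alternating map that is `J`-complex linear in each argument, as a complex alternating map. -/
def AlternatingMap.toComplex {p : ℕ} (J : V →ₗ[ℝ] V) (hJ : J * J = -1) (α : V [⋀^Fin p]→ₗ[ℝ] ℂ)
    (hα : ∀ v k, α (Function.update v k (J (v k))) = Complex.I * α v) :
    letI := complexModule J hJ; V [⋀^Fin p]→ₗ[ℂ] ℂ :=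
  letI := complexModule J hJ
  { toFun := α
    map_update_add' := fun {inst} m i x y => by
      obtain rfl : inst = instDecidableEqFin p := Subsingleton.elim _ _
      exact α.map_update_add m i x y
    map_update_smul' := fun {inst} m i c x => by
      obtain rfl : inst = instDecidableEqFin p := Subsingleton.elim _ _
      rw [complexModule_smul, α.map_update_add,
        α.map_update_smul, α.map_update_smul]
      have h := hα (Function.update m i x) i
      rw [Function.update_idem, Function.update_self] at h
      rw [h]
      simp only [Complex.real_smul, smul_eq_mul]
      nth_rewrite 3 [← Complex.re_add_im c]
      ring
    map_eq_zero_of_eq' := fun v i j h hij => α.map_eq_zero_of_eq v h hij }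

/-- With J as multiplication by i, V has complex dimension p. Both forms are therefore multiples of
the determinant of one complex basis, and c is the ratio of their values on that basis. -/
theorem AlternatingMap.exists_eq_mul_of_complex_linear [FiniteDimensional ℝ V] {p : ℕ}
    (hp : Module.finrank ℝ V = 2 * p) (J : V →ₗ[ℝ] V) (hJ : J * J = -1)
    (α β : V [⋀^Fin p]→ₗ[ℝ] ℂ)
    (hα : ∀ v k, α (Function.update v k (J (v k))) = Complex.I * α v)
    (hβ : ∀ v k, β (Function.update v k (J (v k))) = Complex.I * β v)
    (h0 : α ≠ 0) : ∃ c : ℂ, ∀ v, β v = c * α v := by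
  let _ := complexModule J hJ
  have : IsScalarTower ℝ ℂ V := ⟨fun r z v => by
    rw [complexModule_smul, complexModule_smul]; simp [mul_smul]⟩
  have : FiniteDimensional ℂ V := FiniteDimensional.right ℝ ℂ V
  have hfr : Module.finrank ℂ V = p := by
    have := Module.finrank_mul_finrank ℝ ℂ V
    rw [Complex.finrank_real_complex, hp] at this
    omega
  let e := Module.finBasisOfFinrankEq ℂ V hfr
  have key : ∀ (γ : V [⋀^Fin p]→ₗ[ℝ] ℂ)
      (_ : ∀ v k, γ (Function.update v k (J (v k))) = Complex.I * γ v) (v : Fin p → V),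
      γ v = γ e * e.det v := fun γ hγ v =>
    congrArg (fun f : V [⋀^Fin p]→ₗ[ℂ] ℂ => f v) ((γ.toComplex J hJ hγ).eq_smul_basis_det e)
  have hαe : α e ≠ 0 := fun h => h0 (AlternatingMap.ext fun v => by simp [key α hα v, h])
  refine ⟨β e / α e, fun v => ?_⟩
  rw [key β hβ v, key α hα v]
  field_simp

end LinearAlgebra

/-! ### Smooth vector fields and forms -/

section Manifold

variable {E : Type*} [NormedAddCommGroup E] [NormedSpace ℝ E]
  {M : Type*} [TopologicalSpace M] [ChartedSpace E M] [IsManifold 𝓘(ℝ, E) ∞ M]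

/-- A local smooth extension of v is cut off by a bump function equal to 1 at x. This turns
identities stated for global smooth fields into statements about a single tangent vector. -/
theorem VField.exists_isSmooth_apply_eq [FiniteDimensional ℝ E] [T2Space M] (x : M)
    (v : TangentSpace 𝓘(ℝ, E) x) : ∃ Y : VField E M, Y.IsSmooth ∧ Y x = v := by
  obtain ⟨s, hs, hsm⟩ := FiberBundle.exists_contMDiffOn_extend (k := ∞) 𝓘(ℝ, E) E
    (V := (TangentSpace 𝓘(ℝ, E) : M → Type _)) v
  obtain ⟨u, hus, hu, hxu⟩ := mem_nhds_iff.mp hs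
  obtain ⟨f, -, hf⟩ :=
    (SmoothBumpFunction.nhds_basis_tsupport (I := 𝓘(ℝ, E)) x).mem_iff.mp (hu.mem_nhds hxu)
  refine ⟨fun y => f y • FiberBundle.extend E v y,
    ContMDiffOn.smul_section_of_tsupport f.contMDiff.contMDiffOn hu hf (hsm.mono hus), ?_⟩
  simp

theorem VField.IsSmooth.mdifferentiableAt {X : VField E M} (hX : X.IsSmooth) (x : M) :
    MDifferentiableAt 𝓘(ℝ, E) 𝓘(ℝ, E).tangent
      (fun x => (⟨x, X x⟩ : TangentBundle 𝓘(ℝ, E) M)) x :=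
  (ContMDiff.contMDiffAt hX).mdifferentiableAt (by simp)

theorem EndField.IsSmooth.app {J : EndField E M} (hJ : J.IsSmooth) {X : VField E M}
    (hX : X.IsSmooth) : (J.app X).IsSmooth :=
  ContMDiff.clm_bundle_apply (b := id) hJ hX

-- Only real linearity of L is needed, so this serves both for multiplication by i and for
-- conjugation.
omit [IsManifold 𝓘(ℝ, E) ∞ M] in
theorem mfderiv_clm_comp_apply (L : ℂ →L[ℝ] ℂ) {f g : M → ℂ} (hg : ∀ y, g y = L (f y)) {x : M}
    (hf : MDifferentiableAt 𝓘(ℝ, E) 𝓘(ℝ, ℂ) f x) (v : TangentSpace 𝓘(ℝ, E) x) :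
    (mfderiv 𝓘(ℝ, E) 𝓘(ℝ, ℂ) g x v : ℂ) = L (mfderiv 𝓘(ℝ, E) 𝓘(ℝ, ℂ) f x v) := by
  obtain rfl : g = L ∘ f := funext hg
  rw [mfderiv_comp x L.differentiableAt.mdifferentiableAt hf, mfderiv_eq_fderiv,
    ContinuousLinearMap.fderiv]
  rfl

namespace CForm

variable {p : ℕ} {η : CForm E M p}
  {cov : CovariantDerivative 𝓘(ℝ, E) E (TangentSpace 𝓘(ℝ, E) : M → Type _)}

theorem IsSmooth.mdifferentiableAt (hη : η.IsSmooth) {X : Fin p → VField E M}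
    (hX : ∀ k, (X k).IsSmooth) (x : M) :
    MDifferentiableAt 𝓘(ℝ, E) 𝓘(ℝ, ℂ) (fun y => η y (fun k => X k y)) x :=
  (hη X hX).contMDiffAt.mdifferentiableAt (by simp)

omit [IsManifold 𝓘(ℝ, E) ∞ M] in
theorem apply_update_succAbove (η : CForm E M p) (x : M)
    (v : Fin (p + 1) → TangentSpace 𝓘(ℝ, E) x) (i : Fin (p + 1)) (k : Fin p)
    (w : TangentSpace 𝓘(ℝ, E) x) :
    η x (Function.update (fun l => v (i.succAbove l)) k w) =
      η x (i.removeNth (Function.update v (i.succAbove k) w)) := by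
  congr 1
  exact (Function.update_comp_eq_of_injective v Fin.succAbove_right_injective k w).symm

-- Put w at both places i and j: removing either place leaves lists that differ by a permutation,
-- whose sign is compensated by the powers of -1.
omit [IsManifold 𝓘(ℝ, E) ∞ M] in
theorem apply_removeNth_update_swap (η : CForm E M p) (x : M)
    (v : Fin (p + 1) → TangentSpace 𝓘(ℝ, E) x) {i j : Fin (p + 1)} (hij : i ≠ j)
    (w : TangentSpace 𝓘(ℝ, E) x) :
    (-1 : ℂ) ^ (i : ℕ) * η x (i.removeNth (Function.update v j w)) =
      -((-1 : ℂ) ^ (j : ℕ) * η x (j.removeNth (Function.update v i w))) := by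
  have h := (η x).toAlternatingMap.neg_one_pow_smul_map_removeNth_add_eq_zero_of_eq
    (v := Function.update (Function.update v i w) j w) (i := i) (j := j)
    (by rw [Function.update_self, Function.update_of_ne hij, Function.update_self]) hij
  rw [Fin.removeNth_update, Function.update_comm hij, Fin.removeNth_update] at h
  rw [eq_neg_iff_add_eq_zero]
  simp only [zsmul_eq_mul] at h
  push_cast at h
  exact h

/-- For a torsion-free connection, `dη` is the alternation of `∇η`. -/
theorem d_eq_sum_covDeriv [FiniteDimensional ℝ E] [CompleteSpace E] (η : CForm E M p)
    (hcov : cov.torsion = 0) {X : Fin (p + 1) → VField E M} (hX : ∀ k, (X k).IsSmooth) (x : M) :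
    η.d X x = ∑ i : Fin (p + 1), (-1 : ℂ) ^ (i : ℕ) *
      η.covDeriv cov (fun k => X (i.succAbove k)) x (X i x) := by
  -- Zero torsion: each bracket becomes a difference of covariant derivatives.
  have hbr : ∀ i j, VectorField.mlieBracket 𝓘(ℝ, E) (X i) (X j) x =
      cov (X j) x (X i x) - cov (X i) x (X j x) := fun i j =>
    ((CovariantDerivative.torsion_eq_zero_iff cov).mp hcov ((hX i).mdifferentiableAt x)
      ((hX j).mdifferentiableAt x)).symm
  set v : Fin (p + 1) → TangentSpace 𝓘(ℝ, E) x := fun m => X m x with hv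
  set D : Fin (p + 1) → Fin (p + 1) → TangentSpace 𝓘(ℝ, E) x := fun i j => cov (X j) x (X i x)
    with hD
  set T : Fin (p + 1) → Fin (p + 1) → TangentSpace 𝓘(ℝ, E) x → ℂ := fun i j w =>
    (-1 : ℂ) ^ (i : ℕ) * η x (i.removeNth (Function.update v j w)) with hT
  have hTsub : ∀ i j w w', i ≠ j → T i j (w - w') = T i j w - T i j w' := by
    intro i j w w' hij
    obtain ⟨k, rfl⟩ := Fin.exists_succAbove_eq hij.symm
    simp only [hT]
    rw [← apply_update_succAbove, ← apply_update_succAbove, ← apply_update_succAbove,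
      (η x).map_update_sub, mul_sub]
  have hleft : ∀ i : Fin (p + 1), (-1 : ℂ) ^ (i : ℕ) * ∑ k : Fin p,
      (if i < i.succAbove k then η x (Function.update (fun l => X (i.succAbove l) x) k
          (VectorField.mlieBracket 𝓘(ℝ, E) (X i) (X (i.succAbove k)) x)) else 0) =
      ∑ j, if i < j then T i j (D i j) - T i j (D j i) else 0 := by
    intro i
    rw [Fin.sum_univ_succAbove _ i, if_neg (lt_irrefl i), zero_add, Finset.mul_sum]
    refine Finset.sum_congr rfl fun k _ => ?_
    split_ifs with h
    · rw [hbr, ← hTsub _ _ _ _ h.ne]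
      exact congrArg _ (apply_update_succAbove η x v i k _)
    · simp
  have hright : ∀ i : Fin (p + 1), (-1 : ℂ) ^ (i : ℕ) * ∑ k : Fin p,
      η x (Function.update (fun l => X (i.succAbove l) x) k
          (cov (X (i.succAbove k)) x (X i x))) =
      ∑ j, ((if i < j then T i j (D i j) else 0) + if j < i then T i j (D i j) else 0) := by
    intro i
    rw [Fin.sum_univ_succAbove _ i, if_neg (lt_irrefl i), add_zero, zero_add, Finset.mul_sum]
    refine Finset.sum_congr rfl fun k _ => ?_
    trans T i (i.succAbove k) (D i (i.succAbove k))
    · exact congrArg _ (apply_update_succAbove η x v i k _)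
    · rcases lt_or_gt_of_ne (Fin.succAbove_ne i k) with h | h
      · rw [if_pos h, if_neg h.asymm, zero_add]
      · rw [if_pos h, if_neg h.asymm, add_zero]
  simp only [d, covDeriv, mul_sub, Finset.sum_sub_distrib]
  congr 1
  simp only [hleft, hright]
  simp only [Finset.sum_add_distrib]
  -- The `j < i` half of the double sum is transposed, so that it matches the second term of each
  -- bracket over `i < j`; the signs agree by `apply_removeNth_update_swap`.
  rw [Finset.sum_comm (f := fun i j => if j < i then T i j (D i j) else 0)]
  simp only [← Finset.sum_add_distrib]
  refine Finset.sum_congr rfl fun i _ => Finset.sum_congr rfl fun j _ => ?_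
  split_ifs with h
  · rw [sub_eq_add_neg]
    congr 1
    rw [neg_eq_iff_eq_neg]
    exact apply_removeNth_update_swap η x v h.ne _
  · simp

theorem IsTypePZero.dirDeriv {J : EndField E M} (hη : η.IsTypePZero J) (hs : η.IsSmooth)
    {X : Fin p → VField E M} (hX : ∀ k, (X k).IsSmooth) (k : Fin p) (x : M)
    (v : TangentSpace 𝓘(ℝ, E) x) :
    η.dirDeriv (Function.update X k (J.app (X k))) x v = Complex.I * η.dirDeriv X x v := by
  refine mfderiv_clm_comp_apply (Complex.I • ContinuousLinearMap.id ℝ ℂ) (fun y => ?_)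
    (hs.mdifferentiableAt hX x) v
  refine Eq.trans ?_ (hη y _ k)
  congr 1
  funext l
  by_cases hl : l = k
  · subst hl; simp [EndField.app]
  · simp [hl]

/-- Since ∇J = 0, each ∇_vη is again of type (p, 0). -/
theorem IsTypePZero.covDeriv {J : EndField E M} (hη : η.IsTypePZero J) (hs : η.IsSmooth)
    (hJ : IsParallelEnd cov J) {X : Fin p → VField E M} (hX : ∀ k, (X k).IsSmooth) (k : Fin p)
    (x : M) (v : TangentSpace 𝓘(ℝ, E) x) :
    η.covDeriv cov (Function.update X k (J.app (X k))) x v =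
      Complex.I * η.covDeriv cov X x v := by
  unfold CForm.covDeriv
  rw [hη.dirDeriv hs hX, mul_sub, Finset.mul_sum]
  congr 1
  refine Finset.sum_congr rfl fun l _ => ?_
  have hu : (fun m => Function.update X k (J.app (X k)) m x) =
      Function.update (fun m => X m x) k (J x (X k x)) := by
    funext m
    by_cases hm : m = k
    · subst hm; simp [EndField.app]
    · simp [hm]
  rw [hu]
  by_cases hl : l = k
  · subst hl
    have h := hη x (Function.update (fun m => X m x) l (cov (X l) x v)) l
    simp only [Function.update_idem, Function.update_self] at h
    rw [Function.update_idem, Function.update_self, hJ _ (hX l), h]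
  · have h := hη x (Function.update (fun m => X m x) l (cov (X l) x v)) k
    rw [Function.update_of_ne (Ne.symm hl), Function.update_comm hl] at h
    rw [Function.update_of_ne hl, h]

/-- `∇_{JY} η = i ∇_Y η` for a holomorphic section `η` of `Λ^{p,0}` and a torsion-free connection
with `∇ J = 0`: the `(0, 1)`-part of `∇η` is `∂̄η`. -/
theorem IsHolomorphicSection.covDeriv_app [FiniteDimensional ℝ E] [CompleteSpace E]
    {J : EndField E M} (hη : η.IsHolomorphicSection J) (hJ : IsParallelEnd cov J)
    (hJs : IsComplexStructure J) (hcov : cov.torsion = 0) {Y : VField E M} (hY : Y.IsSmooth)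
    {X : Fin p → VField E M} (hX : ∀ k, (X k).IsSmooth) (x : M) :
    η.covDeriv cov X x (J x (Y x)) = Complex.I * η.covDeriv cov X x (Y x) := by
  have hJY : (J.app Y).IsSmooth := hJs.smooth.app hY
  have hZ : ∀ Y' : VField E M, Y'.IsSmooth → ∀ k, (Fin.cons Y' X : Fin (p + 1) → VField E M) k
      |>.IsSmooth := fun Y' hY' k => by
    refine Fin.cases ?_ (fun l => ?_) k
    · simpa using hY'
    · simpa using hX l
  have h := hη.dbar_eq_zero Y X hY hX x
  have hi : ∀ i : Fin p, η.covDeriv cov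
        (fun k => (Fin.cons (J.app Y) X : Fin (p + 1) → VField E M) (i.succ.succAbove k)) x
        (X i x) =
      Complex.I * η.covDeriv cov
        (fun k => (Fin.cons Y X : Fin (p + 1) → VField E M) (i.succ.succAbove k)) x (X i x) := by
    intro i
    -- `k` is the position that Y occupies once `X i` has been removed from the list Y, X₁, …, X_p.
    obtain ⟨k, hk⟩ := Fin.exists_succAbove_eq (Fin.succ_ne_zero i).symm
    rw [← hη.type_p_zero.covDeriv hη.smooth hJ (fun l => hZ Y hY _) k]
    congr 1
    funext l
    by_cases hl : l = k
    · subst hl; simp [hk]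
    · have : i.succ.succAbove l ≠ 0 := fun h0 =>
        hl (Fin.succAbove_right_injective (h0.trans hk.symm))
      obtain ⟨m, hm⟩ := Fin.exists_succ_eq.mpr this
      simp [hl, ← hm]
  rw [dbar, d_eq_sum_covDeriv η hcov (hZ Y hY), d_eq_sum_covDeriv η hcov (hZ _ hJY),
    Fin.sum_univ_succ, Fin.sum_univ_succ] at h
  simp only [Fin.cons_zero, Fin.cons_succ, hi, Fin.succAbove_zero] at h
  have hsum : ∑ i : Fin p, (-1 : ℂ) ^ ((i.succ : Fin (p + 1)) : ℕ) * (Complex.I * η.covDeriv cov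
        (fun k => (Fin.cons Y X : Fin (p + 1) → VField E M) (i.succ.succAbove k)) x (X i x)) =
      Complex.I * ∑ i : Fin p, (-1 : ℂ) ^ ((i.succ : Fin (p + 1)) : ℕ) * η.covDeriv cov
        (fun k => (Fin.cons Y X : Fin (p + 1) → VField E M) (i.succ.succAbove k)) x (X i x) := by
    rw [Finset.mul_sum]
    exact Finset.sum_congr rfl fun i _ => by ring
  rw [hsum] at h
  simp only [Fin.val_zero, pow_zero, one_mul] at h
  change 1 / 2 * (_ + Complex.I * (η.covDeriv cov X x (J x (Y x)) + _)) = _ at h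
  set S := ∑ i : Fin p, (-1 : ℂ) ^ ((i.succ : Fin (p + 1)) : ℕ) * η.covDeriv cov
    (fun k => (Fin.cons Y X : Fin (p + 1) → VField E M) (i.succ.succAbove k)) x (X i x)
  -- The terms differentiating along the `X i` contribute S + i·(iS) = 0 to ∂̄η; what remains is
  -- ∇_Yη + i∇_{JY}η = 0.
  linear_combination (-2 * Complex.I) * h +
    (η.covDeriv cov X x (J x (Y x)) + Complex.I * S) * Complex.I_sq

/-- `∇ J = 0` implies that `∇` commutes with `η ↦ conj (η(J ·, …, J ·))`. -/
theorem covDeriv_of_conj_apply_eq {J : EndField E M} (hs : η.IsSmooth)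
    (hJ : IsParallelEnd cov J) {c : ℂ}
    (hc : ∀ x v, (starRingEnd ℂ) (η x (fun k => J x (v k))) = c * η x v)
    {X : Fin p → VField E M} (hX : ∀ k, (X k).IsSmooth) (x : M) (v : TangentSpace 𝓘(ℝ, E) x) :
    (starRingEnd ℂ) (η.covDeriv cov (fun k => J.app (X k)) x v) = c * η.covDeriv cov X x v := by
  unfold CForm.covDeriv
  rw [map_sub, map_sum, mul_sub, Finset.mul_sum]
  congr 1
  -- Conjugating `hc` shows that η(JX₁, …, JX_p) is the conjugate of c·η(X₁, …, X_p). As c is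
  -- constant, this is a fixed real-linear map applied to a function.
  · have hd := mfderiv_clm_comp_apply
      ((Complex.conjCLE : ℂ →L[ℝ] ℂ).comp (c • ContinuousLinearMap.id ℝ ℂ))
      (g := fun y => η y (fun l => J.app (X l) y)) (fun y => ?_) (hs.mdifferentiableAt hX x) v
    · exact (congrArg (starRingEnd ℂ) hd).trans (Complex.conj_conj _)
    · refine Eq.trans (Complex.conj_conj _).symm (congrArg (starRingEnd ℂ) ?_)
      exact hc y (fun l => X l y)
  · refine Finset.sum_congr rfl fun l _ => ?_
    rw [hJ _ (hX l), ← hc]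
    congr 2
    funext m
    by_cases hm : m = l
    · subst hm; simp
    · simp [hm, EndField.app]

end CForm

/-- A holomorphic section `η` of `Λ^{p,0}(M, I)` with `conj (η(J ·, …, J ·)) = c η`, `c ≠ 0` a
constant, is parallel for the Obata connection. -/
theorem IsObataConnection.isParallel_of_conj_apply_eq [FiniteDimensional ℝ E] [CompleteSpace E]
    [T2Space M] {A : HypercomplexStructure E M}
    {cov : CovariantDerivative 𝓘(ℝ, E) E (TangentSpace 𝓘(ℝ, E) : M → Type _)}
    (hcov : IsObataConnection A cov) {p : ℕ} {η : CForm E M p}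
    (hη : η.IsHolomorphicSection A.I) {c : ℂ} (hc0 : c ≠ 0)
    (hc : ∀ x v, (starRingEnd ℂ) (η x (fun k => A.J x (v k))) = c * η x v) :
    η.IsParallel cov := by
  intro X hX x v
  obtain ⟨Y, hY, rfl⟩ := VField.exists_isSmooth_apply_eq x v
  have hJX : ∀ k, (A.J.app (X k)).IsSmooth := fun k => A.complex_J.smooth.app (hX k)
  have hconj := fun w => CForm.covDeriv_of_conj_apply_eq hη.smooth hcov.parallel_J hc hX x w
  have hI := fun {Z : Fin p → VField E M} (hZ : ∀ k, (Z k).IsSmooth) =>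
    hη.covDeriv_app hcov.parallel_I A.complex_I hcov.torsion_eq_zero hY hZ x
  have h1 := hconj (A.I x (Y x))
  -- Pulling I out before conjugation gives -i on the left and +i on the right.
  rw [hI hX, hI hJX, map_mul, hconj, Complex.conj_I] at h1
  have h2 : c * η.covDeriv cov X x (Y x) = 0 := by
    linear_combination (Complex.I / 2) * h1 + c * η.covDeriv cov X x (Y x) * Complex.I_sq
  exact (mul_eq_zero.mp h2).resolve_left hc0

end Manifold

/-! ### Left-invariant forms on `Γ \ G` -/

section Invariant

variable {E : Type*} [NormedAddCommGroup E] [NormedSpace ℝ E]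
  {G : Type*} [TopologicalSpace G] [ChartedSpace E G] [Group G] [LieGroup 𝓘(ℝ, E) ∞ G]
  (Γ : Subgroup G) [DiscreteTopology Γ]

/-- The relation b a⁻¹ ∈ Γ is closed because a discrete subgroup of a Hausdorff group is closed. The
Hausdorff property is what the bump functions require. -/
theorem LeftQuotient.t2Space [IsTopologicalGroup G] [T2Space G] : T2Space (LeftQuotient Γ) := by
  have h : IsOpenQuotientMap (LeftQuotient.proj Γ) :=
    ⟨LeftQuotient.proj_surjective Γ, (LeftQuotient.isLocalHomeomorph_proj Γ).continuous,
      (LeftQuotient.isLocalHomeomorph_proj Γ).isOpenMap⟩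
  rw [t2Space_iff_of_isOpenQuotientMap h]
  simp only [LeftQuotient.proj_eq_iff]
  exact (Subgroup.isClosed_of_discrete (H := Γ)).preimage
    (f := fun q : G × G => q.2 * q.1⁻¹) (by fun_prop)

theorem surjective_mfderiv_mul_left (g h : G) :
    Function.Surjective (mfderiv 𝓘(ℝ, E) 𝓘(ℝ, E) (fun a => g * a) h) := by
  intro w
  have hd : ∀ a b : G, MDifferentiableAt 𝓘(ℝ, E) 𝓘(ℝ, E) (fun x => a * x) b := fun a b =>
    (contMDiff_mul_left (I := 𝓘(ℝ, E)) (n := ∞)).contMDiffAt.mdifferentiableAt (by simp)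
  have hcomp : (fun x => g * x) ∘ (fun x => g⁻¹ * x) = id := by ext; simp
  have h1 : mfderiv 𝓘(ℝ, E) 𝓘(ℝ, E) ((fun x => g * x) ∘ (fun x => g⁻¹ * x)) (g * h) w = w := by
    rw [hcomp, mfderiv_id]; rfl
  rw [mfderiv_comp (I' := 𝓘(ℝ, E)) _ (hd _ _) (hd _ _)] at h1
  rw [inv_mul_cancel_left] at h1
  exact ⟨_, h1⟩

/-- A linear frame at each point of `Γ \ G`, in which invariant tensors are constant. -/
theorem exists_invariant_frame {A : HypercomplexStructure E (LeftQuotient Γ)}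
    {B : HypercomplexStructure E G} (hB : B.IsLeftInvariant)
    (hBA : IsHypercomplexMap B A (LeftQuotient.proj Γ)) {p : ℕ} {η : CForm E (LeftQuotient Γ) p}
    (hinv : IsLeftInvariantForm Γ η) (x : LeftQuotient Γ) :
    ∃ P : TangentSpace 𝓘(ℝ, E) (1 : G) →L[ℝ] TangentSpace 𝓘(ℝ, E) x,
      Function.Surjective P ∧ (∀ v, P (B.I 1 v) = A.I x (P v)) ∧
      (∀ v, P (B.J 1 v) = A.J x (P v)) ∧
      ∀ v, η x (fun k => P (v k)) = pullbackForm Γ η 1 v := by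
  obtain ⟨g, rfl⟩ : ∃ g : G, LeftQuotient.proj Γ (g * 1) = x := by
    simpa using LeftQuotient.proj_surjective Γ x
  refine ⟨(mfderiv 𝓘(ℝ, E) 𝓘(ℝ, E) (LeftQuotient.proj Γ) (g * 1)).comp
    (mfderiv 𝓘(ℝ, E) 𝓘(ℝ, E) (fun a => g * a) 1), ?_, fun v => ?_, fun v => ?_, fun v => ?_⟩
  · exact ((LeftQuotient.isLocalDiffeomorph_proj (E := E) Γ
      (g * 1)).mfderivToContinuousLinearEquiv (by simp)).surjective.comp
      (surjective_mfderiv_mul_left g 1)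
  · exact (congrArg _ ((hB g).1.2 1 v)).trans (hBA.1.2 (g * 1) _)
  · exact (congrArg _ ((hB g).2.1.2 1 v)).trans (hBA.2.1.2 (g * 1) _)
  · exact congrArg (fun f => f v) (hinv g 1)

/-- The quaternionic conjugate of a left-invariant form of type `(p, 0)`, with `dim G = 2 p`, is a
constant multiple of the form. -/
theorem IsLeftInvariantForm.exists_conj_apply_eq [FiniteDimensional ℝ E]
    {A : HypercomplexStructure E (LeftQuotient Γ)} (hA : IsInducedHypercomplex Γ A) {p : ℕ}
    (hp : Module.finrank ℝ E = 2 * p) {η : CForm E (LeftQuotient Γ) p}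
    (hη : η.IsTypePZero A.I) (hinv : IsLeftInvariantForm Γ η) (h0 : η ≠ 0) :
    ∃ c : ℂ, c ≠ 0 ∧
      ∀ x v, (starRingEnd ℂ) (η x (fun k => A.J x (v k))) = c * η x v := by
  obtain ⟨B, hB, hBA⟩ := hA
  have frame := exists_invariant_frame Γ hB hBA hinv
  set α := pullbackForm Γ η 1
  have hα0 : α ≠ 0 := by
    intro h
    apply h0
    funext x
    obtain ⟨P, hP, -, -, hPα⟩ := frame x
    ext v
    choose w hw using fun k => hP (v k)
    have := hPα w
    simp only [hw] at this
    rw [this, h]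
    rfl
  have hαI : ∀ v k, α (Function.update v k (B.I 1 (v k))) = Complex.I * α v := by
    intro v k
    obtain ⟨P, -, hPI, -, hPα⟩ := frame (LeftQuotient.proj Γ 1)
    rw [← hPα, ← hPα, ← hη _ _ k]
    congr 1
    funext l
    by_cases hl : l = k
    · subst hl; simp [hPI]
    · simp [hl]
  have hJJ := B.complex_J.sq 1
  set β : TangentSpace 𝓘(ℝ, E) (1 : G) [⋀^Fin p]→ₗ[ℝ] ℂ :=
    (Complex.conjAe.toLinearMap).compAlternatingMap
      (α.toAlternatingMap.compLinearMap (B.J 1).toLinearMap)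
  have hβ : ∀ v, β v = (starRingEnd ℂ) (α fun k => B.J 1 (v k)) := fun v => rfl
  have hβI : ∀ v k, β (Function.update v k (B.I 1 (v k))) = Complex.I * β v := by
    intro v k
    -- The sign from JI = -IJ will cancel the one from conj(i) = -i.
    have hu : (fun l => B.J 1 (Function.update v k (B.I 1 (v k)) l)) =
        Function.update (fun l => B.J 1 (v l)) k (-B.I 1 (B.J 1 (v k))) := by
      funext l
      by_cases hl : l = k
      · subst hl; simp [B.J_I, B.I_J]
      · simp [hl]
    rw [hβ, hβ, hu, show α _ = _ from α.toAlternatingMap.map_update_neg _ k _,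
      show α.toAlternatingMap _ = _ from hαI (fun l => B.J 1 (v l)) k, map_neg, map_mul,
      Complex.conj_I, neg_mul, neg_neg]
  obtain ⟨c, hc⟩ := AlternatingMap.exists_eq_mul_of_complex_linear
    (V := E) hp (B.I 1).toLinearMap
    (LinearMap.ext fun v => B.complex_I.sq 1 v) α.toAlternatingMap β hαI hβI
    (fun h => hα0 (ContinuousAlternatingMap.toAlternatingMap_injective h))
  have hc' : ∀ v, (starRingEnd ℂ) (α fun k => B.J 1 (v k)) = c * α v := hc
  refine ⟨c, ?_, fun x v => ?_⟩
  -- Evaluating on -Jv undoes J, so c = 0 would force α = 0.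
  · rintro rfl
    apply hα0
    ext v
    have h := hc' fun k => -B.J 1 (v k)
    simp only [map_neg, hJJ, neg_neg, zero_mul, map_eq_zero] at h
    exact h
  -- The frame carries the relation from the identity to x with the same c.
  · obtain ⟨P, hP, -, hPJ, hPα⟩ := frame x
    choose w hw using fun k => hP (v k)
    obtain rfl : (fun k => P (w k)) = v := funext hw
    simp only [← hPJ]
    rw [hPα, hPα, hc']

end Invariant

end

theorem mainTheorem4 (n : ℕ) {G : Type*} [TopologicalSpace G] [T2Space G]
    [ChartedSpace (EuclideanSpace ℝ (Fin (4 * n))) G] [Group G]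
    [LieGroup 𝓘(ℝ, EuclideanSpace ℝ (Fin (4 * n))) ∞ G]
    [SimplyConnectedSpace G] [Group.IsNilpotent G]
    (Γ : Subgroup G) [DiscreteTopology Γ] [CompactSpace (LeftQuotient Γ)]
    (A : HypercomplexStructure (EuclideanSpace ℝ (Fin (4 * n))) (LeftQuotient Γ))
    (hA : IsInducedHypercomplex Γ A)
    (cov : CovariantDerivative 𝓘(ℝ, EuclideanSpace ℝ (Fin (4 * n)))
      (EuclideanSpace ℝ (Fin (4 * n)))
      (TangentSpace 𝓘(ℝ, EuclideanSpace ℝ (Fin (4 * n))) : LeftQuotient Γ → Type _))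
    (hcov : IsObataConnection A cov)
    (η : CForm (EuclideanSpace ℝ (Fin (4 * n))) (LeftQuotient Γ) (2 * n))
    (hη : η.IsHolomorphicSection A.I)
    (hinv : IsLeftInvariantForm Γ η) :
    η.IsParallel cov := by
  have : IsTopologicalGroup G :=
    topologicalGroup_of_lieGroup 𝓘(ℝ, EuclideanSpace ℝ (Fin (4 * n))) ∞
  have := LeftQuotient.t2Space Γ
  -- The zero form is treated apart, since c ≠ 0 is available only for η ≠ 0.
  by_cases h0 : η = 0
  · subst h0
    intro X _ x v
    simp [CForm.covDeriv, CForm.dirDeriv]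
    exact sub_self (0 : ℂ)
  · obtain ⟨c, hc0, hc⟩ := hinv.exists_conj_apply_eq Γ hA (by simp; ring) hη.type_p_zero h0
    exact hcov.isParallel_of_conj_apply_eq hη hc0 hc
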